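/- \textbf{Setting.} Let $\omega=e^{2\pi i/3}$, $\lambda\in\mathbb Z\setminus\{0\}$, $B=\frac{1}{8\pi\lambda^2\operatorname{Im}\omega}>0$, and let $\Gamma_\lambda=\gamma_1\mathbb Z\oplus\gamma_2\mathbb Z$ with $\gamma_1=4\pi i\omega\lambda$, $\gamma_2=4\pi i\omega^2\lambda$, so that the flux of $B$ through $E_\lambda=\mathbb C/\Gamma_\lambda$ is $2\pi$ (one flux quantum). For $\gamma=m\gamma_1+n\gamma_2$ define the magnetic translation $\mathbb T_\gamma u(z)=e^{i\pi mn}\exp\big(\tfrac{iB}{2}\operatorname{Im}(\bar\gamma z)\big)u(z+\gamma)$, and let $L^2_B(E_\lambda)=\{f\in L^2_{\mathrm{loc}}(\mathbb C):\mathbb T_\gamma f=f\ \text{for all }\gamma\in\Gamma_\lambda\}$, with the norm of $L^2(E_\lambda)$. Let $A(z)=-\frac B2 iz$, $D_z=-i\partial_z$, $D_{\bar z}=-i\partial_{\bar z}$ and, for $\mathbf k\in\mathbb C$ (a representative of a class in $\mathbb C/\Gamma_\lambda^*$), \[ a_{\mathbf k}=2\big(D_z+\tfrac{\bar{\mathbf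 k}}2\big)-\overline{A(z)},\qquad a_{\mathbf k}^*=2\big(D_{\bar z}+\tfrac{\mathbf k}2\big)-A(z),\qquad H_{D,\mathbf k}=\begin{pmatrix}0&a_{\mathbf k}\\a_{\mathbf k}^*&0\end{pmatrix}, \] where $H_{D,\mathbf k}$ acts on $L^2_B(E_\lambda;\mathbb C^2)$ with domain all $u$ for which $H_{D,\mathbf k}u$, taken in the sense of distributions, belongs to $L^2_B(E_\lambda;\mathbb C^2)$. \textbf{Proposition.} For every such $\lambda$, every $\mathbf k\in\mathbb C$ and every constant $C_0\in\mathbb C\setminus\{0\}$ there is a sequence of smooth Bloch functions $\psi_{n,\mathbf k}\in L^2_B(E_\lambda)$, $n\ge 0$, with \[ a_{\mathbf k}\psi_{0,\mathbf k}=0,\qquad a_{\mathbf k}\psi_{n,\mathbf k}=\sqrt{2Bn}\,\psi_{n-1,\mathbf k}\ (n\ge1),\qquad a_{\mathbf k}^*\psi_{n,\mathbf k}=\sqrt{2B(n+1)}\,\psi_{n+1,\mathbf k}\ (n\ge0), \] whose zero mode is \[ \psi_{0,\mathbf k}(z)=C_0\,e^{-B|z|^2/4}\,f_{\mathbf k}(\bar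 z)\,e^{-B\bar z^2/4}\,e^{-i\operatorname{Re}(z\bar{\mathbf k})},\qquad f_{\mathbf k}(w)=e^{-(\operatorname{Im}\mathbf k)\,w}\,\vartheta_{\frac12,\frac12}\Big(\frac{w}{-4\pi\lambda i}-z_{\mathbf k}\,\Big|\,\omega\Big), \] where $z_{\mathbf k}=-2\lambda\omega\operatorname{Im}\mathbf k-i\lambda\omega\mathbf k+i\lambda\bar\omega\bar{\mathbf k}+\frac12$ and $\vartheta_{a,b}(z|\tau)=\sum_{n\in\mathbb Z}\exp\big(\pi i(a+n)^2\tau+2\pi i(n+a)(z+b)\big)$ is the Jacobi theta function with characteristics. All $\psi_{n,\mathbf k}$ have the same nonzero norm in $L^2(E_\lambda)$ (so $C_0$ can be chosen to normalize all of them). With $\psi_{-1,\mathbf k}:=0$, for every $n\in\mathbb Z$ the function \[ u_{n,\mathbf k}=C_n'\begin{pmatrix}\operatorname{sgn}(n)\,\psi_{|n|-1,\mathbf k}\\ \psi_{|n|,\mathbf k}\end{pmatrix},\qquad C'_0=1,\quad C'_n=\tfrac1{\sqrt2}\ (n\ne0), \] is an eigenfunction of $H_{D,\mathbf k}$ with eigenvalue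 $\operatorname{sgn}(n)\sqrt{2|n|B}$, and its norm in $L^2(E_\lambda;\mathbb C^2)$ equals that of $\psi_{0,\mathbf k}$. -/

import Mathlib

open MeasureTheory Complex
open scoped ContDiff ComplexConjugate

noncomputable section

namespace MagneticTorus

/-- `ω = exp(2πi/3)`. -/
def om : ℂ := Complex.exp (2 * Real.pi * I / 3)

/-- The first generator `γ₁ = 4πiωλ` of the scaled lattice `Γ_λ`. -/
def gamma1 (lam : ℤ) : ℂ := 4 * Real.pi * om * I * lam

/-- The second generator `γ₂ = 4πiω²λ` of the scaled lattice `Γ_λ`. -/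
def gamma2 (lam : ℤ) : ℂ := 4 * Real.pi * om ^ 2 * I * lam

/-- The field strength `B = 1 / (8πλ² Im ω)`: the flux through a cell of `Γ_λ` is `2π`. -/
def fieldB (lam : ℤ) : ℝ := 1 / (8 * Real.pi * (lam : ℝ) ^ 2 * om.im)

/-- `D_z = -i∂_z`, where `∂_z = (∂_{x₁} - i∂_{x₂}) / 2`. -/
def Dz (u : ℂ → ℂ) (z : ℂ) : ℂ :=
  -I * ((fderiv ℝ u z 1 - I * fderiv ℝ u z I) / 2)

/-- `D_z̄ = -i∂_z̄`, where `∂_z̄ = (∂_{x₁} + i∂_{x₂}) / 2`. -/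
def Dzbar (u : ℂ → ℂ) (z : ℂ) : ℂ :=
  -I * ((fderiv ℝ u z 1 + I * fderiv ℝ u z I) / 2)

/-- The vector potential `A(z) = -(B/2) i z` of the constant field in the symmetric gauge. -/
def vecA (lam : ℤ) (z : ℂ) : ℂ := -((fieldB lam : ℂ) / 2) * I * z

/-- `a_k`: the operator `a = 2D_z - Ā` with `D_z` replaced by `D_z + k̄/2`. -/
def aOp (lam : ℤ) (k : ℂ) (u : ℂ → ℂ) (z : ℂ) : ℂ :=
  2 * (Dz u z + conj k / 2 * u z) - conj (vecA lam z) * u z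

/-- `a_k^*`: the operator `a^* = 2D_z̄ - A` with `D_z̄` replaced by `D_z̄ + k/2`. -/
def aStarOp (lam : ℤ) (k : ℂ) (u : ℂ → ℂ) (z : ℂ) : ℂ :=
  2 * (Dzbar u z + k / 2 * u z) - vecA lam z * u z

/-- The differential expression `H_{D,k} = (0, a_k; a_k^*, 0)` acting on spinors. -/
def diracExpr (lam : ℤ) (k : ℂ) (u : ℂ → Fin 2 → ℂ) (z : ℂ) : Fin 2 → ℂ :=
  ![aOp lam k (fun w => u w 1) z, aStarOp lam k (fun w => u w 0) z]

/-- The magnetic translation `𝕋_γ` for `γ = mγ₁ + nγ₂` at unit flux: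
`𝕋_γ u(z) = e^{iπmn} exp((iB/2) Im(γ̄ z)) u(z + γ)`. -/
def magTranslation (lam m n : ℤ) (u : ℂ → ℂ) (z : ℂ) : ℂ :=
  Complex.exp (I * m * n * Real.pi) *
    Complex.exp (I * (fieldB lam : ℂ) / 2 *
      ((conj ((m : ℂ) * gamma1 lam + (n : ℂ) * gamma2 lam) * z).im : ℂ)) *
    u (z + ((m : ℂ) * gamma1 lam + (n : ℂ) * gamma2 lam))

/-- Membership in `L²_B(E_λ)`: locally square integrable and, almost everywhere, invariant under
all magnetic translations. -/
def MemL2B (lam : ℤ) (f : ℂ → ℂ) : Prop :=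
  (∀ K : Set ℂ, IsCompact K → MemLp f 2 (volume.restrict K)) ∧
    ∀ m n : ℤ, magTranslation lam m n f =ᵐ[volume] f

/-- A fundamental cell of the lattice `Γ_λ`, representing `E_λ = ℂ / Γ_λ`. -/
def cell (lam : ℤ) : Set ℂ :=
  {z | ∃ s t : ℝ, s ∈ Set.Ico (0 : ℝ) 1 ∧ t ∈ Set.Ico (0 : ℝ) 1 ∧
    z = (s : ℂ) * gamma1 lam + (t : ℂ) * gamma2 lam}

/-- Squared norm of a scalar function in `L²(E_λ)`. -/
def normSqCell (lam : ℤ) (f : ℂ → ℂ) : ℝ := ∫ z in cell lam, ‖f z‖ ^ 2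

/-- Squared norm of a spinor in `L²(E_λ; ℂ²)`. -/
def spinorNormSqCell (lam : ℤ) (u : ℂ → Fin 2 → ℂ) : ℝ :=
  ∫ z in cell lam, (‖u z 0‖ ^ 2 + ‖u z 1‖ ^ 2)

/-- The graph of the operator `H_{D,k}` on `L²_B(E_λ; ℂ²)`: its domain consists of all `u` in the
space for which `H_{D,k} u`, in the sense of distributions, is an element `v` of the space. As the
expression `H_{D,k}` is formally self-adjoint, this means `⟨H_{D,k} Φ, u⟩ = ⟨Φ, v⟩` for all test
spinors `Φ`. -/
def DiracGraph (lam : ℤ) (k : ℂ) (u v : ℂ → Fin 2 → ℂ) : Prop :=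
  (∀ i, MemL2B lam (fun z => u z i)) ∧ (∀ i, MemL2B lam (fun z => v z i)) ∧
    ∀ Φ : ℂ → Fin 2 → ℂ, ContDiff ℝ ∞ Φ → HasCompactSupport Φ →
      ∫ z, ∑ i, conj (diracExpr lam k Φ z i) * u z i = ∫ z, ∑ i, conj (Φ z i) * v z i

/-- `u` is an eigenfunction of the operator `H_{D,k}` with eigenvalue `μ`; in particular it is in
the domain and is not zero as an element of `L²_B(E_λ; ℂ²)`. -/
def IsDiracEigenfunction (lam : ℤ) (k : ℂ) (u : ℂ → Fin 2 → ℂ) (μ : ℝ) : Prop :=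
  (¬ ∀ᵐ z ∂(volume : Measure ℂ), u z = 0) ∧
    DiracGraph lam k u (fun z i => (μ : ℂ) * u z i)

/-- The Jacobi theta function with characteristics
`ϑ_{a,b}(z|τ) = ∑_{n ∈ ℤ} exp(πi(a + n)²τ + 2πi(n + a)(z + b))`. -/
def thetaChar (a b : ℝ) (z τ : ℂ) : ℂ :=
  ∑' n : ℤ, Complex.exp (Real.pi * I * ((a : ℂ) + n) ^ 2 * τ +
    2 * Real.pi * I * ((n : ℂ) + a) * (z + b))

/-- The defining series of the theta function converges absolutely in the upper half plane. -/
theorem summable_thetaChar (a b : ℝ) (z τ : ℂ) (hτ : 0 < τ.im) :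
    Summable (fun n : ℤ => Complex.exp (Real.pi * I * ((a : ℂ) + n) ^ 2 * τ +
      2 * Real.pi * I * ((n : ℂ) + a) * (z + b))) := by
  have h : Summable (fun n : ℤ => jacobiTheta₂_term n (z + b + a * τ) τ) :=
    (summable_jacobiTheta₂_term_iff _ _).2 hτ
  refine (h.mul_left
    (Complex.exp (Real.pi * I * (a : ℂ) ^ 2 * τ + 2 * Real.pi * I * a * (z + b)))).congr ?_
  intro n
  rw [jacobiTheta₂_term, ← Complex.exp_add]
  congr 1
  ring

/-- `z_k = -2λω Im k - iλωk + iλω̄k̄ + 1/2`. -/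
def zk (lam : ℤ) (k : ℂ) : ℂ :=
  -2 * lam * om * (k.im : ℂ) - I * lam * om * k + I * lam * conj om * conj k + 1 / 2

/-- `f_k(w) = e^{-(Im k) w} ϑ_{1/2,1/2}(w / (-4πλi) - z_k | ω)`. -/
def fk (lam : ℤ) (k w : ℂ) : ℂ :=
  Complex.exp (-(k.im : ℂ) * w) *
    thetaChar (1 / 2) (1 / 2) (w / (-4 * Real.pi * lam * I) - zk lam k) om

/-- The zero mode up to its multiplicative constant:
`e^{-B|z|²/4} f_k(z̄) e^{-B z̄²/4} e^{-i Re(z k̄)}`. -/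
def zeroMode (lam : ℤ) (k z : ℂ) : ℂ :=
  Complex.exp (-((‖z‖ ^ 2 * fieldB lam / 4 : ℝ) : ℂ)) * fk lam k (conj z) *
    Complex.exp (-((fieldB lam : ℂ) * (conj z) ^ 2 / 4)) *
    Complex.exp (-I * ((z * conj k).re : ℂ))

/-- `C'_n`, equal to `1` for `n = 0` and to `1/√2` otherwise. -/
def Cprime (n : ℤ) : ℝ := if n = 0 then 1 else 1 / Real.sqrt 2

/-- `u_n = C'_n (sgn(n) ψ_{|n|-1}, ψ_{|n|})`; for `n = 0` the first entry vanishes, in agreement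
with the convention `ψ_{-1} = 0`. -/
def spinorMode (ψ : ℕ → ℂ → ℂ) (n : ℤ) (z : ℂ) : Fin 2 → ℂ :=
  ![(Cprime n : ℂ) * ((n.sign : ℂ) * ψ (n.natAbs - 1) z), (Cprime n : ℂ) * ψ n.natAbs z]

/-- The Landau level `sgn(n) √(2|n|B)`. -/
def landauLevel (lam n : ℤ) : ℝ :=
  (n.sign : ℝ) * Real.sqrt (2 * |(n : ℝ)| * fieldB lam)

end MagneticTorus

end

noncomputable section

namespace MagneticTorus

/-! ### Differential operators and magnetic translations -/

/-! The argument is the algebra of the harmonic oscillator, with `a_k` lowering and `a_k^*` raising.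
In the symmetric gauge `[a_k, a_k^*] = 2B` (`aOp_aStarOp`), and `a_k^*` commutes with the magnetic
translations (`aStarOp_magTranslation`). A magnetically periodic zero mode therefore generates all
levels by normalized raising (`landauMode`), and induction with the commutator gives the lowering
relation (`aOp_landauMode_succ`).

Two facts are needed about the zero mode. It is a Gaussian gauge factor times an entire function of
`z̄`, and `a_k` annihilates every such product (`aOp_zeroMode`). Its periodicity
(`magTranslation_zeroMode`) is the quasi-periodicity of the theta function: the lattice shifts the
theta argument by an element of `ℤ + ℤω`, and the resulting multiplier cancels against the Gaussian,
the plane wave and the magnetic phase. It is nontrivial because `θ(0|ω) ≠ 0` and an entire function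
vanishing on an open set is zero.

For the norms, `conj (a_k^* u) * w - conj u * a_k w` is a total derivative. If `u` and `w` are
magnetically periodic, the product `conj u * w` is truly periodic, so that derivative integrates to
zero over the cell. Hence `a_k^*` is adjoint to `a_k`, and all levels have equal norm. The same
identity against test spinors turns the classical eigenvalue equation into the distributional one
required by `DiracGraph`. -/

/-- The point `mγ₁ + nγ₂` of the lattice. -/
def latticePt (lam m n : ℤ) : ℂ := (m : ℂ) * gamma1 lam + (n : ℂ) * gamma2 lam

/-- The unimodular factor of the magnetic translation by `mγ₁ + nγ₂`. -/
def magPhase (lam m n : ℤ) (z : ℂ) : ℂ :=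
  Complex.exp (I * m * n * Real.pi) *
    Complex.exp (I * (fieldB lam : ℂ) / 2 * ((conj (latticePt lam m n) * z).im : ℂ))

theorem magTranslation_apply (lam m n : ℤ) (u : ℂ → ℂ) (z : ℂ) :
    magTranslation lam m n u z = magPhase lam m n z * u (z + latticePt lam m n) := rfl

theorem norm_magPhase (lam m n : ℤ) (z : ℂ) : ‖magPhase lam m n z‖ = 1 := by
  have h1 : I * m * n * Real.pi = ((m * n * Real.pi : ℝ) : ℂ) * I := by push_cast; ring
  have h2 : I * (fieldB lam : ℂ) / 2 * ((conj (latticePt lam m n) * z).im : ℂ) =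
      ((fieldB lam / 2 * (conj (latticePt lam m n) * z).im : ℝ) : ℂ) * I := by push_cast; ring
  rw [magPhase, h1, h2, norm_mul, norm_exp_ofReal_mul_I, norm_exp_ofReal_mul_I, one_mul]

theorem hasFDerivAt_magPhase (lam m n : ℤ) (z : ℂ) :
    HasFDerivAt (magPhase lam m n)
      (magPhase lam m n z • ((I * (fieldB lam : ℂ) / 2) • (ofRealCLM.comp
        (imCLM.comp ((ContinuousLinearMap.mul ℝ ℂ) (conj (latticePt lam m n))))))) z := by
  have h : HasFDerivAt (fun z : ℂ => ((conj (latticePt lam m n) * z).im : ℂ)) (ofRealCLM.comp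
        (imCLM.comp ((ContinuousLinearMap.mul ℝ ℂ) (conj (latticePt lam m n))))) z :=
    (ofRealCLM.comp
        (imCLM.comp ((ContinuousLinearMap.mul ℝ ℂ) (conj (latticePt lam m n))))).hasFDerivAt
  have := ((h.const_mul (I * (fieldB lam : ℂ) / 2)).cexp).const_mul
    (Complex.exp (I * m * n * Real.pi))
  refine HasFDerivAt.congr_fderiv this ?_
  rw [smul_smul]; rfl

theorem fderiv_magTranslation {u : ℂ → ℂ} (hu : Differentiable ℝ u) (lam m n : ℤ) (z v : ℂ) :
    fderiv ℝ (magTranslation lam m n u) z v = magPhase lam m n z *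
      (I * (fieldB lam : ℂ) / 2 * ((conj (latticePt lam m n) * v).im : ℂ) *
        u (z + latticePt lam m n) + fderiv ℝ u (z + latticePt lam m n) v) := by
  have h : HasFDerivAt (fun z => u (z + latticePt lam m n))
      (fderiv ℝ u (z + latticePt lam m n)) z :=
    (hasFDerivAt_comp_add_right _).2 (hu _).hasFDerivAt
  have key := (hasFDerivAt_magPhase lam m n z).fun_mul h
  rw [show magTranslation lam m n u = fun z => magPhase lam m n z * u (z + latticePt lam m n) from
    rfl]
  rw [key.fderiv]
  simp only [add_apply, smul_apply,
    ContinuousLinearMap.comp_apply, ContinuousLinearMap.mul_apply', imCLM_apply, ofRealCLM_apply,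
    smul_eq_mul]
  ring

/-- Differentiating the phase produces `iBγ/2`, exactly the change of `-A` under `z ↦ z + γ`. Only
`a_k^*` is treated, since every level is reached by raising. -/
theorem aStarOp_magTranslation {u : ℂ → ℂ} (hu : Differentiable ℝ u) (lam m n : ℤ) (k : ℂ) :
    aStarOp lam k (magTranslation lam m n u) = magTranslation lam m n (aStarOp lam k u) := by
  funext z
  simp only [aStarOp, Dzbar, fderiv_magTranslation hu, magTranslation_apply, vecA]
  have h1 : ((conj (latticePt lam m n) * 1).im : ℂ) = -((latticePt lam m n).im : ℂ) := by
    simp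
  have h2 : ((conj (latticePt lam m n) * I).im : ℂ) = ((latticePt lam m n).re : ℂ) := by simp
  rw [h1, h2]
  have h3 := re_add_im (latticePt lam m n)
  have hI := I_sq
  generalize (latticePt lam m n) = g at *
  linear_combination (-magPhase lam m n z * (fieldB lam : ℂ) / 2 * u (z + g) *
    (I * g.re)) * hI + (magPhase lam m n z * (fieldB lam : ℂ) / 2 * I * u (z + g)) * h3

theorem Dz_conj_mul {u w : ℂ → ℂ} (hu : Differentiable ℝ u) (hw : Differentiable ℝ w) (z : ℂ) :
    Dz (fun z => conj (u z) * w z) z = -conj (Dzbar u z) * w z + conj (u z) * Dz w z := by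
  have hc : HasFDerivAt (fun z => conj (u z)) ((conjCLE : ℂ →L[ℝ] ℂ).comp (fderiv ℝ u z)) z :=
    (conjCLE : ℂ →L[ℝ] ℂ).hasFDerivAt.comp z (hu z).hasFDerivAt
  simp only [Dz, Dzbar, (hc.fun_mul (hw z).hasFDerivAt).fderiv]
  simp [map_ofNat]
  ring

/-- The zeroth-order terms are complex conjugates and cancel, leaving the product rule. Both
integrations by parts, over the plane and over the cell, rest on this pointwise identity. -/
theorem conj_aStarOp_mul {u w : ℂ → ℂ} (hu : Differentiable ℝ u) (hw : Differentiable ℝ w)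
    (lam : ℤ) (k z : ℂ) :
    conj (aStarOp lam k u z) * w z - conj (u z) * aOp lam k w z =
      -2 * Dz (fun z => conj (u z) * w z) z := by
  rw [Dz_conj_mul hu hw]
  simp [aStarOp, aOp, vecA, map_ofNat]
  ring

theorem contDiff_fderiv_apply {u : ℂ → ℂ} (hu : ContDiff ℝ ∞ u) (v : ℂ) :
    ContDiff ℝ ∞ (fun z => fderiv ℝ u z v) :=
  (hu.fderiv_right (m := ∞) (by simp)).clm_apply contDiff_const

theorem contDiff_Dz {u : ℂ → ℂ} (hu : ContDiff ℝ ∞ u) : ContDiff ℝ ∞ (Dz u) :=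
  contDiff_const.mul (((contDiff_fderiv_apply hu 1).sub
    (contDiff_const.mul (contDiff_fderiv_apply hu I))).div_const 2)

theorem contDiff_Dzbar {u : ℂ → ℂ} (hu : ContDiff ℝ ∞ u) : ContDiff ℝ ∞ (Dzbar u) :=
  contDiff_const.mul (((contDiff_fderiv_apply hu 1).add
    (contDiff_const.mul (contDiff_fderiv_apply hu I))).div_const 2)

theorem contDiff_vecA (lam : ℤ) : ContDiff ℝ ∞ (vecA lam) :=
  contDiff_const.mul contDiff_id

theorem contDiff_aOp {u : ℂ → ℂ} (hu : ContDiff ℝ ∞ u) (lam : ℤ) (k : ℂ) :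
    ContDiff ℝ ∞ (aOp lam k u) :=
  (contDiff_const.mul ((contDiff_Dz hu).add (contDiff_const.mul hu))).sub
    (((conjCLE : ℂ →L[ℝ] ℂ).contDiff.comp (contDiff_vecA lam)).mul hu)

theorem contDiff_aStarOp {u : ℂ → ℂ} (hu : ContDiff ℝ ∞ u) (lam : ℤ) (k : ℂ) :
    ContDiff ℝ ∞ (aStarOp lam k u) :=
  (contDiff_const.mul ((contDiff_Dzbar hu).add (contDiff_const.mul hu))).sub
    ((contDiff_vecA lam).mul hu)

theorem aOp_const_mul {u : ℂ → ℂ} (hu : Differentiable ℝ u) (lam : ℤ) (k c z : ℂ) :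
    aOp lam k (fun z => c * u z) z = c * aOp lam k u z := by
  simp only [aOp, Dz, fderiv_const_mul (hu z), smul_apply, smul_eq_mul]
  ring

theorem aStarOp_const_mul {u : ℂ → ℂ} (hu : Differentiable ℝ u) (lam : ℤ) (k c z : ℂ) :
    aStarOp lam k (fun z => c * u z) z = c * aStarOp lam k u z := by
  simp only [aStarOp, Dzbar, fderiv_const_mul (hu z), smul_apply, smul_eq_mul]
  ring

theorem fderiv_aStarOp {u : ℂ → ℂ} (hu : ContDiff ℝ ∞ u) (lam : ℤ) (k z v : ℂ) :
    fderiv ℝ (aStarOp lam k u) z v =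
      -I * (fderiv ℝ (fderiv ℝ u) z v 1 + I * fderiv ℝ (fderiv ℝ u) z v I) +
        k * fderiv ℝ u z v + (fieldB lam : ℂ) / 2 * I * (v * u z + z * fderiv ℝ u z v) := by
  have hd : Differentiable ℝ (fderiv ℝ u) :=
    (hu.fderiv_right (m := ∞) (by simp)).differentiable (by simp)
  have h2 (c : ℂ) : HasFDerivAt (fun z => fderiv ℝ u z c)
      ((ContinuousLinearMap.apply ℝ ℂ c).comp (fderiv ℝ (fderiv ℝ u) z)) z :=
    (ContinuousLinearMap.apply ℝ ℂ c).hasFDerivAt.comp z (hd z).hasFDerivAt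
  have h0 := (hu.differentiable (by simp) z).hasFDerivAt
  have key : HasFDerivAt (aStarOp lam k u) _ z :=
    ((((h2 1).fun_add ((h2 I).const_mul I)).const_mul (-I)).fun_add (h0.const_mul k)).fun_add
      (((hasFDerivAt_id z).fun_mul h0).const_mul ((fieldB lam : ℂ) / 2 * I)) |>.congr_of_eventuallyEq
      (Filter.Eventually.of_forall fun z => by simp [aStarOp, Dzbar, vecA]; ring)
  rw [key.fderiv]
  simp
  ring

theorem fderiv_aOp {u : ℂ → ℂ} (hu : ContDiff ℝ ∞ u) (lam : ℤ) (k z v : ℂ) :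
    fderiv ℝ (aOp lam k u) z v =
      -I * (fderiv ℝ (fderiv ℝ u) z v 1 - I * fderiv ℝ (fderiv ℝ u) z v I) +
        conj k * fderiv ℝ u z v -
        (fieldB lam : ℂ) / 2 * I * (conj v * u z + conj z * fderiv ℝ u z v) := by
  have hd : Differentiable ℝ (fderiv ℝ u) :=
    (hu.fderiv_right (m := ∞) (by simp)).differentiable (by simp)
  have h2 (c : ℂ) : HasFDerivAt (fun z => fderiv ℝ u z c)
      ((ContinuousLinearMap.apply ℝ ℂ c).comp (fderiv ℝ (fderiv ℝ u) z)) z :=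
    (ContinuousLinearMap.apply ℝ ℂ c).hasFDerivAt.comp z (hd z).hasFDerivAt
  have h0 := (hu.differentiable (by simp) z).hasFDerivAt
  have key : HasFDerivAt (aOp lam k u) _ z :=
    ((((h2 1).fun_sub ((h2 I).const_mul I)).const_mul (-I)).fun_add (h0.const_mul (conj k))).fun_sub
      ((((conjCLE : ℂ →L[ℝ] ℂ).hasFDerivAt (x := z)).fun_mul h0).const_mul
        ((fieldB lam : ℂ) / 2 * I)) |>.congr_of_eventuallyEq
      (Filter.Eventually.of_forall fun z => by simp [aOp, Dz, vecA, map_ofNat]; ring)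
  rw [key.fderiv]
  simp
  ring

/-- The canonical commutation relation `[a_k, a_k^*] = 2B`. -/
theorem aOp_aStarOp {u : ℂ → ℂ} (hu : ContDiff ℝ ∞ u) (lam : ℤ) (k z : ℂ) :
    aOp lam k (aStarOp lam k u) z =
      aStarOp lam k (aOp lam k u) z + 2 * (fieldB lam : ℂ) * u z := by
  -- Symmetry of the second derivative cancels the second-order terms; only the derivatives of the
  -- potential survive.
  have hs : fderiv ℝ (fderiv ℝ u) z 1 I = fderiv ℝ (fderiv ℝ u) z I 1 :=
    ((hu.of_le (WithTop.coe_le_coe.2 le_top)).contDiffAt.isSymmSndFDerivAt (n := 2) (by simp)).eq 1 I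
  rw [aOp, aStarOp.eq_1 lam k (aOp lam k u), Dz, Dzbar, fderiv_aStarOp hu, fderiv_aStarOp hu,
    fderiv_aOp hu, fderiv_aOp hu, hs]
  simp only [aOp, aStarOp, Dz, Dzbar, vecA, map_one, conj_I, map_neg, map_mul, map_div₀, conj_ofReal,
    map_ofNat]
  linear_combination (-2 * (fieldB lam : ℂ) * u z + (fieldB lam : ℂ) * u z * I ^ 2) * I_sq

/-! ### The cube root of unity -/

theorem om_eq : om = -1 / 2 + (Real.sqrt 3 / 2 : ℝ) * I := by
  have h : (2 * Real.pi * I / 3 : ℂ) = ((Real.pi - Real.pi / 3 : ℝ) : ℂ) * I := by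
    push_cast; ring
  rw [om, h, exp_mul_I, ← ofReal_cos, ← ofReal_sin, Real.cos_pi_sub, Real.sin_pi_sub,
    Real.cos_pi_div_three, Real.sin_pi_div_three]
  push_cast; ring

theorem om_im : om.im = Real.sqrt 3 / 2 := by
  rw [om_eq]; simp

theorem om_im_pos : 0 < om.im := by
  rw [om_im]; positivity

theorem om_sq : om ^ 2 = -1 - om := by
  have h3 : ((Real.sqrt 3 : ℝ) : ℂ) ^ 2 = 3 := by
    rw [← ofReal_pow, Real.sq_sqrt (by norm_num)]; norm_num
  rw [om_eq]
  push_cast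
  linear_combination (((Real.sqrt 3 : ℝ) : ℂ) ^ 2 / 4) * I_sq - h3 / 4

theorem conj_om : conj om = -1 - om := by
  rw [om_eq]
  simp only [map_add, map_mul, conj_ofReal, conj_I, map_div₀, map_neg, map_one, map_ofNat]
  ring

theorem fieldB_pos {lam : ℤ} (hlam : lam ≠ 0) : 0 < fieldB lam := by
  have := om_im_pos
  have := Real.pi_pos
  have : (lam : ℝ) ≠ 0 := Int.cast_ne_zero.2 hlam
  rw [fieldB]
  positivity

/-! ### The theta function -/

theorem thetaChar_eq_jacobiTheta₂ (a b : ℝ) (z τ : ℂ) :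
    thetaChar a b z τ = Complex.exp (Real.pi * I * (a : ℂ) ^ 2 * τ + 2 * Real.pi * I * a * (z + b)) *
      jacobiTheta₂ (z + b + a * τ) τ := by
  rw [thetaChar, jacobiTheta₂, ← tsum_mul_left]
  refine tsum_congr fun n => ?_
  rw [jacobiTheta₂_term, ← Complex.exp_add]
  congr 1
  ring

theorem differentiable_thetaChar (a b : ℝ) {τ : ℂ} (hτ : 0 < τ.im) :
    Differentiable ℂ (fun z => thetaChar a b z τ) := by
  intro z
  simp only [thetaChar_eq_jacobiTheta₂]
  refine DifferentiableAt.mul (by fun_prop) ?_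
  exact (differentiableAt_jacobiTheta₂_fst (z + b + a * τ) hτ).comp z
    (f := fun z => z + b + a * τ) (by fun_prop)

/-- Completing the square in the summation index absorbs the shift by `qτ`. The characteristic `a =
1/2` leaves the sign `e^{πip}`. -/
theorem thetaChar_half_add (z τ : ℂ) (p q : ℤ) :
    thetaChar (1 / 2) (1 / 2) (z + p + q * τ) τ =
      Complex.exp (Real.pi * I * (p - q ^ 2 * τ - 2 * q * (z + 1 / 2))) *
        thetaChar (1 / 2) (1 / 2) z τ := by
  rw [thetaChar, thetaChar, ← tsum_mul_left, ← (Equiv.addRight (-q)).tsum_eq]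
  refine tsum_congr fun n => ?_
  rw [← Complex.exp_add, Complex.exp_eq_exp_iff_exists_int]
  -- The `p`-part of the exponent is `2πi(n - q + 1/2)p`; all but `πip` is an integer multiple of
  -- `2πi`.
  refine ⟨(n - q) * p, ?_⟩
  simp only [Equiv.coe_addRight]
  push_cast
  ring

/-- The tail bound is `|θ(ω) - 1| ≤ 2x / (1 - x)` with `x = e^{-π Im ω}`, which is below `1` as soon
as `x < 1/3`. -/
theorem jacobiTheta_om_ne_zero : jacobiTheta om ≠ 0 := by
  intro h
  have h1 := norm_jacobiTheta_sub_one_le om_im_pos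
  rw [h, zero_sub, norm_neg, norm_one, om_im] at h1
  set x := Real.exp (-Real.pi * (Real.sqrt 3 / 2)) with hx
  have hx3 : x < 1 / 3 := by
    have h3 : (5 : ℝ) / 3 < Real.sqrt 3 := Real.lt_sqrt_of_sq_lt (by norm_num)
    have h4 : 2 < Real.pi * (Real.sqrt 3 / 2) := by nlinarith [Real.pi_gt_three]
    have h5 := Real.add_one_le_exp (Real.pi * (Real.sqrt 3 / 2))
    rw [hx, neg_mul, Real.exp_neg, one_div]
    exact inv_strictAnti₀ (by norm_num) (by linarith)
  have h6 : 0 < 1 - x := by linarith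
  rw [div_mul_eq_mul_div, le_div_iff₀ h6] at h1
  linarith

theorem exists_thetaChar_om_ne_zero (a b : ℝ) : ∃ z, thetaChar a b z om ≠ 0 := by
  -- This point makes the argument of the underlying `jacobiTheta₂` zero.
  refine ⟨-b - a * om, ?_⟩
  rw [thetaChar_eq_jacobiTheta₂]
  refine mul_ne_zero (exp_ne_zero _) ?_
  rw [show -(b : ℂ) - a * om + b + a * om = 0 by ring, ← jacobiTheta_eq_jacobiTheta₂]
  exact jacobiTheta_om_ne_zero

/-! ### The zero mode -/

/-- The antiholomorphic part `f_k(w) e^{-B w²/4}` of the zero mode, as a function of `w = z̄`. -/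
def holPart (lam : ℤ) (k w : ℂ) : ℂ :=
  fk lam k w * Complex.exp (-((fieldB lam : ℂ) * w ^ 2 / 4))

theorem differentiable_holPart (lam : ℤ) (k : ℂ) : Differentiable ℂ (holPart lam k) := by
  have h : Differentiable ℂ (fun w : ℂ =>
      thetaChar (1 / 2) (1 / 2) (w / (-4 * Real.pi * lam * I) - zk lam k) om) :=
    (differentiable_thetaChar (1 / 2) (1 / 2) om_im_pos).comp
      (f := fun w : ℂ => w / (-4 * Real.pi * lam * I) - zk lam k) (by fun_prop)
  unfold holPart fk
  fun_prop

/-- The gauge factor of the zero mode. -/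
def zeroGauge (lam : ℤ) (k z : ℂ) : ℂ :=
  Complex.exp (-((fieldB lam : ℂ) / 4) * (z * conj z) - I / 2 * (z * conj k + conj z * k))

theorem zeroMode_eq (lam : ℤ) (k z : ℂ) :
    zeroMode lam k z = zeroGauge lam k z * holPart lam k (conj z) := by
  have h1 : (((z * conj k).re : ℝ) : ℂ) = (z * conj k + conj z * k) / 2 := by
    rw [re_eq_add_conj]; simp
  have h2 : ((‖z‖ ^ 2 * fieldB lam / 4 : ℝ) : ℂ) = z * conj z * fieldB lam / 4 := by
    rw [mul_conj, normSq_eq_norm_sq]; push_cast; ring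
  rw [zeroMode, zeroGauge, holPart, h1, h2, sub_eq_add_neg, Complex.exp_add]
  ring_nf

theorem contDiff_zeroMode (lam : ℤ) (k : ℂ) : ContDiff ℝ ∞ (zeroMode lam k) := by
  have hc : ContDiff ℝ ∞ (fun z : ℂ => conj z) := (conjCLE : ℂ →L[ℝ] ℂ).contDiff
  have hh : ContDiff ℝ ∞ (fun z => holPart lam k (conj z)) :=
    ((differentiable_holPart lam k).contDiff.restrict_scalars ℝ).comp hc
  have hg : ContDiff ℝ ∞ (zeroGauge lam k) := by
    unfold zeroGauge
    exact ContDiff.cexp ((contDiff_const.mul (contDiff_id.mul hc)).sub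
      (contDiff_const.mul ((contDiff_id.mul contDiff_const).add (hc.mul contDiff_const))))
  rw [funext (zeroMode_eq lam k)]
  exact hg.mul hh

theorem aOp_zeroMode (lam : ℤ) (k z : ℂ) : aOp lam k (zeroMode lam k) z = 0 := by
  have hc : HasFDerivAt (fun z : ℂ => conj z) (conjCLE : ℂ →L[ℝ] ℂ) z :=
    (conjCLE : ℂ →L[ℝ] ℂ).hasFDerivAt
  have hh : HasFDerivAt (fun z => holPart lam k (conj z)) _ z :=
    (((differentiable_holPart lam k) (conj z)).hasFDerivAt.restrictScalars ℝ).comp z hc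
  have hg : HasFDerivAt (zeroGauge lam k) _ z :=
    ((((hasFDerivAt_id z).fun_mul hc).const_mul (-((fieldB lam : ℂ) / 4))).fun_sub
      ((((hasFDerivAt_id z).mul_const (conj k)).fun_add (hc.mul_const k)).const_mul (I / 2))).cexp
  have key : HasFDerivAt (zeroMode lam k) _ z :=
    (hg.fun_mul hh).congr_of_eventuallyEq (Filter.Eventually.of_forall (zeroMode_eq lam k))
  -- Complex linearity of the derivative is the Cauchy–Riemann equation: it makes `∂_z` of the
  -- antiholomorphic factor vanish.
  have hlin : fderiv ℂ (holPart lam k) (conj z) (-I) =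
      -I * fderiv ℂ (holPart lam k) (conj z) 1 := by
    rw [← smul_eq_mul, ← map_smul, smul_eq_mul, mul_one]
  simp only [aOp, Dz, key.fderiv, vecA, zeroMode_eq]
  simp [map_ofNat, hlin]
  generalize fderiv ℂ (holPart lam k) (conj z) 1 = d
  rw [show cexp (-((fieldB lam : ℂ) / 4 * (z * conj z)) - I / 2 * (z * conj k + conj z * k)) =
    zeroGauge lam k z by rw [zeroGauge, neg_mul]]
  ring_nf
  simp only [I_sq, I_pow_three, I_pow_four]
  ring

/-- In this form the theta argument `w / (-4πλi)` visibly moves by `-m + (n - m)ω`. -/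
theorem conj_latticePt (lam m n : ℤ) :
    conj (latticePt lam m n) = -4 * Real.pi * lam * I * (-m + (n - m) * om) := by
  simp only [latticePt, gamma1, gamma2, map_add, map_mul, map_pow, conj_om, conj_I, conj_ofReal,
    map_ofNat, map_intCast]
  linear_combination (-4 * Real.pi * I * lam * n) * om_sq

theorem latticePt_eq (lam m n : ℤ) :
    latticePt lam m n = 4 * Real.pi * lam * I * (m * om - n * (1 + om)) := by
  simp only [latticePt, gamma1, gamma2]
  linear_combination (4 * Real.pi * I * lam * n) * om_sq

/-- Since `√3 = -i(2ω + 1)`, the field strength becomes polynomial in `ω`, `i` and inverses, ready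
for algebraic elimination. -/
theorem fieldB_eq (lam : ℤ) :
    (fieldB lam : ℂ) = -I * (2 * om + 1) / 12 * (Real.pi : ℂ)⁻¹ * ((lam : ℂ)⁻¹) ^ 2 := by
  have h3 : ((Real.sqrt 3 : ℝ) : ℂ) ^ 2 = 3 := by
    rw [← ofReal_pow, Real.sq_sqrt (by norm_num)]; norm_num
  have h4 : ((Real.sqrt 3 : ℝ) : ℂ)⁻¹ = (Real.sqrt 3 : ℝ) / 3 := by
    rw [inv_eq_of_mul_eq_one_right]
    linear_combination h3 / 3
  rw [fieldB, om_im, om_eq]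
  push_cast
  rw [one_div, mul_inv, mul_inv, mul_inv, inv_div, div_eq_mul_inv 2, h4, inv_pow]
  ring_nf
  rw [I_sq]
  ring

theorem fk_add (lam : ℤ) (hlam : lam ≠ 0) (k w : ℂ) (m n : ℤ) :
    fk lam k (w + conj (latticePt lam m n)) =
      Complex.exp (-(k.im : ℂ) * conj (latticePt lam m n) + Real.pi * I * (-m - (n - m) ^ 2 * om -
        2 * (n - m) * (w / (-4 * Real.pi * lam * I) - zk lam k + 1 / 2))) * fk lam k w := by
  have hl : (lam : ℂ) ≠ 0 := Int.cast_ne_zero.2 hlam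
  have hp : (Real.pi : ℂ) ≠ 0 := ofReal_ne_zero.2 Real.pi_ne_zero
  have h := thetaChar_half_add (w / (-4 * Real.pi * lam * I) - zk lam k) om (-m) (n - m)
  push_cast at h
  rw [fk, fk, conj_latticePt, show (w + -4 * Real.pi * lam * I * (-m + (n - m) * om)) /
      (-4 * Real.pi * lam * I) - zk lam k =
      w / (-4 * Real.pi * lam * I) - zk lam k + -m + (n - m) * om by
    field_simp
    ring, h, Complex.exp_add, mul_add, Complex.exp_add]
  ring

theorem im_eq (z : ℂ) : (z.im : ℂ) = -I / 2 * (z - conj z) := by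
  rw [im_eq_sub_conj, div_eq_mul_inv, mul_inv, inv_I]; ring

theorem magTranslation_zeroMode {lam : ℤ} (hlam : lam ≠ 0) (k : ℂ) (m n : ℤ) :
    magTranslation lam m n (zeroMode lam k) = zeroMode lam k := by
  have hl : (lam : ℂ) ≠ 0 := Int.cast_ne_zero.2 hlam
  have hp : (Real.pi : ℂ) ≠ 0 := ofReal_ne_zero.2 Real.pi_ne_zero
  -- The exponents agree only modulo `2πi`; the discrepancy is `πi m(m - 1) = 2πi r`.
  obtain ⟨r, hr⟩ := Int.even_mul_pred_self m
  have hr' : (m : ℂ) * (m - 1) = r + r := by exact_mod_cast hr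
  funext z
  rw [magTranslation_apply, zeroMode_eq, zeroMode_eq, holPart, holPart, map_add, fk_add lam hlam,
    zeroGauge, zeroGauge, magPhase]
  generalize hF : fk lam k (conj z) = F
  have key : ∀ a b c d e f g : ℂ, (∃ j : ℤ, a + b + c + d + e = f + g + j * (2 * Real.pi * I)) →
      cexp a * cexp b * (cexp c * (cexp d * F * cexp e)) = cexp f * (F * cexp g) := by
    intro a b c d e f g h
    rw [← Complex.exp_eq_exp_iff_exists_int] at h
    simp only [Complex.exp_add] at h
    linear_combination F * h
  refine key _ _ _ _ _ _ _ ⟨r, ?_⟩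
  simp only [im_eq, map_add, map_mul, conj_conj, zk, conj_om]
  rw [conj_latticePt, latticePt_eq, fieldB_eq]
  have hw : conj z / (-4 * Real.pi * lam * I) =
    conj z * I / 4 * (Real.pi : ℂ)⁻¹ * (lam : ℂ)⁻¹ := by
    field_simp
    rw [I_sq]; ring
  rw [hw]
  have hlu := mul_inv_cancel₀ hl
  have hpu := mul_inv_cancel₀ hp
  have hI := I_sq
  have ho := om_sq
  -- What remains is a polynomial identity modulo `i² = -1`, `ω² = -1 - ω`, `λλ⁻¹ = 1`, `ππ⁻¹ = 1`
  -- and `m(m - 1) = 2r`.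
  generalize (lam : ℂ)⁻¹ = li at *
  generalize (Real.pi : ℂ)⁻¹ = pin at *
  generalize (lam : ℂ) = l at *
  generalize (Real.pi : ℂ) = p at *
  generalize (conj z : ℂ) = w at *
  generalize (conj k : ℂ) = kb at *
  generalize om = o at *
  generalize Complex.I = i at *
  generalize (m : ℂ) = m at *
  generalize (n : ℂ) = n at *
  generalize (r : ℂ) = r at *
  clear key hw hF
  grind

/-! ### Integration by parts against test functions -/

theorem integral_fderiv_eq_zero {F : ℂ → ℂ} (hF : ContDiff ℝ ∞ F) (hc : HasCompactSupport F)
    (v : ℂ) : ∫ z, fderiv ℝ F z v = 0 := by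
  have hi : Integrable F := hF.continuous.integrable_of_hasCompactSupport hc
  have hi' : Integrable (fun z => fderiv ℝ F z v) :=
    (contDiff_fderiv_apply hF v).continuous.integrable_of_hasCompactSupport (hc.fderiv_apply ℝ v)
  have := integral_smul_fderiv_eq_neg_fderiv_smul_of_integrable (𝕜 := ℝ)
    (μ := (volume : Measure ℂ)) (f := fun _ : ℂ => (1 : ℝ)) (g := F) (v := v) (by simp)
    (by simpa using hi')
    (by simpa using hi) (fun _ _ => differentiableAt_const _)
    (fun _ _ => hF.differentiable (by simp) _)
  simpa using this

theorem hasCompactSupport_Dz {F : ℂ → ℂ} (hc : HasCompactSupport F) : HasCompactSupport (Dz F) :=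
  hc.mono' fun z hz => by
    by_contra h
    exact hz (by simp [Dz, fderiv_of_notMem_tsupport ℝ h])

theorem integral_Dz_eq_zero {F : ℂ → ℂ} (hF : ContDiff ℝ ∞ F) (hc : HasCompactSupport F) :
    ∫ z, Dz F z = 0 := by
  have h (v : ℂ) : Integrable (fun z => fderiv ℝ F z v) :=
    (contDiff_fderiv_apply hF v).continuous.integrable_of_hasCompactSupport (hc.fderiv_apply ℝ v)
  simp only [Dz]
  rw [integral_const_mul, integral_div, integral_sub (h 1) ((h I).const_mul I),
    integral_const_mul, integral_fderiv_eq_zero hF hc, integral_fderiv_eq_zero hF hc]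
  simp

theorem contDiff_conj_mul {u w : ℂ → ℂ} (hu : ContDiff ℝ ∞ u) (hw : ContDiff ℝ ∞ w) :
    ContDiff ℝ ∞ (fun z => conj (u z) * w z) :=
  ((conjCLE : ℂ →L[ℝ] ℂ).contDiff.comp hu).mul hw

theorem contDiff_diracExpr {u : ℂ → Fin 2 → ℂ} (hu : ContDiff ℝ ∞ u) (lam : ℤ) (k : ℂ) :
    ContDiff ℝ ∞ (diracExpr lam k u) := by
  rw [contDiff_pi] at hu ⊢
  intro i
  fin_cases i
  · exact contDiff_aOp (hu 1) lam k
  · exact contDiff_aStarOp (hu 0) lam k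

theorem diracExpr_of_notMem_tsupport {u : ℂ → Fin 2 → ℂ} (lam : ℤ) (k : ℂ) {z : ℂ}
    (hz : z ∉ tsupport u) : diracExpr lam k u z = 0 := by
  have h0 : u =ᶠ[nhds z] 0 := notMem_tsupport_iff_eventuallyEq.1 hz
  have h (i : Fin 2) : (fun w => u w i) =ᶠ[nhds z] fun _ => 0 :=
    h0.mono fun w hw => by simp [hw]
  ext i
  fin_cases i <;>
    simp [diracExpr, aOp, aStarOp, Dz, Dzbar, (h _).fderiv_eq, h0.eq_of_nhds]

/-- The Dirac expression is formally self-adjoint. -/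
theorem integral_conj_diracExpr {Φ u : ℂ → Fin 2 → ℂ} (hΦ : ContDiff ℝ ∞ Φ)
    (hc : HasCompactSupport Φ) (hu : ContDiff ℝ ∞ u) (lam : ℤ) (k : ℂ) :
    ∫ z, ∑ i, conj (diracExpr lam k Φ z i) * u z i =
      ∫ z, ∑ i, conj (Φ z i) * diracExpr lam k u z i := by
  have hΦ' := contDiff_pi.1 hΦ
  have hu' := contDiff_pi.1 hu
  have hdΦ := contDiff_pi.1 (contDiff_diracExpr hΦ lam k)
  have hdu := contDiff_pi.1 (contDiff_diracExpr hu lam k)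
  have hΦ0 (z : ℂ) (hz : z ∉ tsupport Φ) : Φ z = 0 := image_eq_zero_of_notMem_tsupport hz
  have i1 : Integrable (fun z => ∑ i, conj (diracExpr lam k Φ z i) * u z i) :=
    (ContDiff.sum fun i _ => contDiff_conj_mul (hdΦ i) (hu' i)).continuous
      |>.integrable_of_hasCompactSupport (HasCompactSupport.intro hc fun z hz => by
        simp [diracExpr_of_notMem_tsupport lam k hz])
  have i2 : Integrable (fun z => ∑ i, conj (Φ z i) * diracExpr lam k u z i) :=
    (ContDiff.sum fun i _ => contDiff_conj_mul (hΦ' i) (hdu i)).continuous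
      |>.integrable_of_hasCompactSupport (HasCompactSupport.intro hc fun z hz => by
        simp [hΦ0 z hz])
  have hF := contDiff_conj_mul (hΦ' 0) (hu' 1)
  have hG := contDiff_conj_mul (hu' 0) (hΦ' 1)
  have cF : HasCompactSupport (fun z => conj (Φ z 0) * u z 1) :=
    HasCompactSupport.intro hc fun z hz => by simp [hΦ0 z hz]
  have cG : HasCompactSupport (fun z => conj (u z 0) * Φ z 1) :=
    HasCompactSupport.intro hc fun z hz => by simp [hΦ0 z hz]
  have iF := (contDiff_Dz hF).continuous.integrable_of_hasCompactSupport (μ := volume)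
    (hasCompactSupport_Dz cF)
  have iG := (contDiff_Dz hG).continuous.integrable_of_hasCompactSupport (μ := volume)
    (hasCompactSupport_Dz cG)
  have iG' : Integrable (fun z => conj (Dz (fun z => conj (u z 0) * Φ z 1) z)) :=
    (conjCLE : ℂ →L[ℝ] ℂ).integrable_comp iG
  rw [← sub_eq_zero, ← integral_sub i1 i2]
  have hd {f : ℂ → ℂ} (hf : ContDiff ℝ ∞ f) : Differentiable ℝ f := hf.differentiable (by simp)
  have key (z : ℂ) : ∑ i, conj (diracExpr lam k Φ z i) * u z i -
      ∑ i, conj (Φ z i) * diracExpr lam k u z i =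
      -2 * Dz (fun z => conj (Φ z 0) * u z 1) z +
        2 * conj (Dz (fun z => conj (u z 0) * Φ z 1) z) := by
    have h1 := conj_aStarOp_mul (hd (hΦ' 0)) (hd (hu' 1)) lam k z
    -- The other off-diagonal entry follows from the same identity, with test spinor and state
    -- exchanged, after conjugation.
    have h2 := congrArg conj (conj_aStarOp_mul (hd (hu' 0)) (hd (hΦ' 1)) lam k z)
    simp only [map_sub, map_mul, map_neg, map_ofNat, conj_conj] at h2
    simp only [Fin.sum_univ_two, diracExpr, Matrix.cons_val_zero, Matrix.cons_val_one]
    linear_combination h1 - h2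
  simp_rw [key]
  rw [integral_add (iF.const_mul _) (iG'.const_mul _), integral_const_mul, integral_const_mul,
    integral_conj, integral_Dz_eq_zero hF cF, integral_Dz_eq_zero hG cG]
  simp

/-! ### Integration over the cell -/

theorem gamma1_ne_zero {lam : ℤ} (hlam : lam ≠ 0) : gamma1 lam ≠ 0 := by
  simp [gamma1, om, hlam, Real.pi_ne_zero]

/-- The linear map taking the unit square to the cell. -/
def cellMap (lam : ℤ) : ℂ →L[ℝ] ℂ :=
  reCLM.smulRight (gamma1 lam) + imCLM.smulRight (gamma2 lam)

theorem cellMap_apply (lam : ℤ) (c : ℂ) :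
    cellMap lam c = (c.re : ℂ) * gamma1 lam + (c.im : ℂ) * gamma2 lam := by
  simp [cellMap]

theorem cellMap_injective {lam : ℤ} (hlam : lam ≠ 0) : Function.Injective (cellMap lam) := by
  rw [injective_iff_map_eq_zero]
  intro c hc
  -- As `γ₂ = ωγ₁`, independence of the periods reduces to `Im ω ≠ 0`.
  have h1 : gamma1 lam * (c.re + c.im * om) = 0 := by
    rw [← hc, cellMap_apply, gamma1, gamma2]; ring
  have h2 := (mul_eq_zero.1 h1).resolve_left (gamma1_ne_zero hlam)
  have h3 : c.im = 0 := by
    have := congrArg im h2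
    simpa [om_im_pos.ne'] using this
  have h4 : c.re = 0 := by
    have := congrArg re h2
    simpa [h3] using this
  exact Complex.ext h4 h3

/-- The half open unit square. -/
def unitSquare : Set ℂ := Set.Ico (0 : ℝ) 1 ×ℂ Set.Ico (0 : ℝ) 1

theorem measurableSet_unitSquare : MeasurableSet unitSquare :=
  (measurable_re measurableSet_Ico).inter (measurable_im measurableSet_Ico)

theorem cell_eq_image (lam : ℤ) : cell lam = cellMap lam '' unitSquare := by
  ext z
  constructor
  · rintro ⟨s, t, hs, ht, rfl⟩
    exact ⟨⟨s, t⟩, ⟨hs, ht⟩, by simp [cellMap_apply]⟩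
  · rintro ⟨c, ⟨hs, ht⟩, rfl⟩
    exact ⟨c.re, c.im, hs, ht, cellMap_apply lam c⟩

theorem exists_isCompact_cell_subset (lam : ℤ) : ∃ K, IsCompact K ∧ cell lam ⊆ K := by
  refine ⟨cellMap lam '' (Set.Icc (0 : ℝ) 1 ×ℂ Set.Icc (0 : ℝ) 1),
    (isCompact_Icc.reProdIm isCompact_Icc).image (cellMap lam).continuous, ?_⟩
  rw [cell_eq_image]
  exact Set.image_mono fun c hc => ⟨Set.Ico_subset_Icc_self hc.1, Set.Ico_subset_Icc_self hc.2⟩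

theorem integrableOn_cell {E : Type*} [NormedAddCommGroup E] (lam : ℤ) {f : ℂ → E}
    (hf : Continuous f) : IntegrableOn f (cell lam) := by
  obtain ⟨K, hK, hs⟩ := exists_isCompact_cell_subset lam
  exact (hf.continuousOn.integrableOn_compact hK).mono_set hs

theorem setIntegral_cell {lam : ℤ} (hlam : lam ≠ 0) {G : ℂ → ℂ} (hG : Continuous G) :
    ∫ z in cell lam, G z = |(cellMap lam).det| •
      ∫ s in Set.Ico (0 : ℝ) 1, ∫ t in Set.Ico (0 : ℝ) 1,
        G ((s : ℂ) * gamma1 lam + (t : ℂ) * gamma2 lam) := by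
  rw [cell_eq_image, integral_image_eq_integral_abs_det_fderiv_smul volume measurableSet_unitSquare
    (fun x _ => (cellMap lam).hasFDerivAt.hasFDerivWithinAt) (cellMap_injective hlam).injOn,
    integral_smul]
  congr 1
  have h := volume_preserving_equiv_real_prod.setIntegral_preimage_emb
    measurableEquivRealProd.measurableEmbedding
    (fun p : ℝ × ℝ => G ((p.1 : ℂ) * gamma1 lam + (p.2 : ℂ) * gamma2 lam))
    (Set.Ico (0 : ℝ) 1 ×ˢ Set.Ico (0 : ℝ) 1)
  have hcont : Continuous
      (fun p : ℝ × ℝ => G ((p.1 : ℂ) * gamma1 lam + (p.2 : ℂ) * gamma2 lam)) :=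
    hG.comp (by fun_prop)
  rw [Measure.volume_eq_prod, setIntegral_prod _ ((hcont.continuousOn.integrableOn_compact
    (isCompact_Icc.prod isCompact_Icc)).mono_set
    (Set.prod_mono Set.Ico_subset_Icc_self Set.Ico_subset_Icc_self))] at h
  rw [← h]
  simp only [cellMap_apply]
  rfl

/-- Both orders of integration are needed, so that the inner integral can run along either period.
-/
theorem setIntegral_cell' {lam : ℤ} (hlam : lam ≠ 0) {G : ℂ → ℂ} (hG : Continuous G) :
    ∫ z in cell lam, G z = |(cellMap lam).det| •
      ∫ t in Set.Ico (0 : ℝ) 1, ∫ s in Set.Ico (0 : ℝ) 1,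
        G ((s : ℂ) * gamma1 lam + (t : ℂ) * gamma2 lam) := by
  have hcont : Continuous
      (fun p : ℝ × ℝ => G ((p.1 : ℂ) * gamma1 lam + (p.2 : ℂ) * gamma2 lam)) :=
    hG.comp (by fun_prop)
  rw [setIntegral_cell hlam hG, integral_integral_swap]
  rw [Measure.prod_restrict]
  exact (hcont.continuousOn.integrableOn_compact
    (isCompact_Icc.prod isCompact_Icc)).mono_set
    (Set.prod_mono Set.Ico_subset_Icc_self Set.Ico_subset_Icc_self)

/-- Integral over a period of the derivative in the direction of the period. -/
theorem integral_fderiv_period {F : ℂ → ℂ} (hF : ContDiff ℝ ∞ F) {g : ℂ}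
    (hg : ∀ z, F (z + g) = F z) (z : ℂ) :
    ∫ s in Set.Ico (0 : ℝ) 1, fderiv ℝ F (z + s * g) g = 0 := by
  have hd (s : ℝ) : HasDerivAt (fun s : ℝ => F (z + s * g)) (fderiv ℝ F (z + s * g) g) s := by
    have h1 : HasDerivAt (fun s : ℝ => z + s * g) g s := by
      simpa using (((hasDerivAt_id s).ofReal_comp).mul_const g).const_add z
    exact (hF.differentiable (by simp) _).hasFDerivAt.comp_hasDerivAt s h1
  have hc : Continuous (fun s : ℝ => fderiv ℝ F (z + s * g) g) :=
    (contDiff_fderiv_apply hF g).continuous.comp (by fun_prop)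
  rw [integral_Ico_eq_integral_Ioc, ← intervalIntegral.integral_of_le zero_le_one,
    intervalIntegral.integral_eq_sub_of_hasDerivAt (fun s _ => hd s) (hc.intervalIntegrable _ _)]
  simp [hg]

/-- The periods span the plane over the reals, so it suffices to differentiate along each period,
where the inner integral is that of a derivative over a full period. -/
theorem setIntegral_cell_fderiv_eq_zero {lam : ℤ} (hlam : lam ≠ 0) {F : ℂ → ℂ}
    (hF : ContDiff ℝ ∞ F) (h1 : ∀ z, F (z + gamma1 lam) = F z)
    (h2 : ∀ z, F (z + gamma2 lam) = F z) (v : ℂ) :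
    ∫ z in cell lam, fderiv ℝ F z v = 0 := by
  obtain ⟨c, rfl⟩ := (LinearMap.injective_iff_surjective (f := (cellMap lam : ℂ →ₗ[ℝ] ℂ))).1
    (cellMap_injective hlam) v
  have hc (g : ℂ) := (contDiff_fderiv_apply hF g).continuous
  have e1 : ∫ z in cell lam, fderiv ℝ F z (gamma1 lam) = 0 := by
    rw [setIntegral_cell' hlam (hc _)]
    simp only [add_comm ((_ : ℂ) * gamma1 lam), integral_fderiv_period hF h1]
    simp
  have e2 : ∫ z in cell lam, fderiv ℝ F z (gamma2 lam) = 0 := by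
    rw [setIntegral_cell hlam (hc _)]
    simp only [integral_fderiv_period hF h2]
    simp
  have e3 (z : ℂ) : fderiv ℝ F z (cellMap lam c) =
      c.re • fderiv ℝ F z (gamma1 lam) + c.im • fderiv ℝ F z (gamma2 lam) := by
    rw [← map_smul, ← map_smul, ← map_add, cellMap_apply]; simp
  simp only [ContinuousLinearMap.coe_coe, e3]
  have hi (r : ℝ) (g : ℂ) : IntegrableOn (fun z => r • fderiv ℝ F z g) (cell lam) :=
    integrableOn_cell lam ((hc g).const_smul r)
  rw [integral_add (hi _ _) (hi _ _), integral_smul, integral_smul, e1, e2]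
  simp

theorem setIntegral_cell_Dz_eq_zero {lam : ℤ} (hlam : lam ≠ 0) {F : ℂ → ℂ}
    (hF : ContDiff ℝ ∞ F) (h1 : ∀ z, F (z + gamma1 lam) = F z)
    (h2 : ∀ z, F (z + gamma2 lam) = F z) :
    ∫ z in cell lam, Dz F z = 0 := by
  have h (v : ℂ) := integrableOn_cell lam (contDiff_fderiv_apply hF v).continuous
  simp only [Dz]
  rw [integral_const_mul, integral_div, integral_sub (h 1) ((h I).const_mul I),
    integral_const_mul, setIntegral_cell_fderiv_eq_zero hlam hF h1 h2,
    setIntegral_cell_fderiv_eq_zero hlam hF h1 h2]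
  simp

/-- Both factors carry the same unimodular phase, which cancels in the sesquilinear product. -/
theorem conj_mul_periodic {lam : ℤ} {u w : ℂ → ℂ} (m n : ℤ) (hu : magTranslation lam m n u = u)
    (hw : magTranslation lam m n w = w) (z : ℂ) :
    conj (u (z + latticePt lam m n)) * w (z + latticePt lam m n) = conj (u z) * w z := by
  conv_rhs => rw [← hu, ← hw]
  rw [magTranslation_apply, magTranslation_apply, map_mul]
  have h : conj (magPhase lam m n z) * magPhase lam m n z = 1 := by
    rw [mul_comm, mul_conj, normSq_eq_norm_sq, norm_magPhase]; simp
  linear_combination -(conj (u (z + latticePt lam m n)) * w (z + latticePt lam m n)) * h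

/-- `a_k^*` is the adjoint of `a_k` on smooth magnetically periodic functions. -/
theorem setIntegral_cell_conj_aStarOp_mul {lam : ℤ} (hlam : lam ≠ 0) (k : ℂ) {u w : ℂ → ℂ}
    (hu : ContDiff ℝ ∞ u) (hw : ContDiff ℝ ∞ w) (hu' : ∀ m n, magTranslation lam m n u = u)
    (hw' : ∀ m n, magTranslation lam m n w = w) :
    ∫ z in cell lam, conj (aStarOp lam k u z) * w z =
      ∫ z in cell lam, conj (u z) * aOp lam k w z := by
  have hF := contDiff_conj_mul hu hw
  have h1 (z : ℂ) := conj_mul_periodic 1 0 (hu' 1 0) (hw' 1 0) z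
  have h2 (z : ℂ) := conj_mul_periodic 0 1 (hu' 0 1) (hw' 0 1) z
  simp only [latticePt, Int.cast_one, Int.cast_zero, one_mul, zero_mul, add_zero, zero_add]
    at h1 h2
  rw [← sub_eq_zero, ← integral_sub
    (integrableOn_cell lam (contDiff_conj_mul (contDiff_aStarOp hu lam k) hw).continuous)
    (integrableOn_cell lam (contDiff_conj_mul hu (contDiff_aOp hw lam k)).continuous)]
  simp_rw [conj_aStarOp_mul (hu.differentiable (by simp)) (hw.differentiable (by simp))]
  rw [integral_const_mul, setIntegral_cell_Dz_eq_zero hlam hF h1 h2, mul_zero]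

/-! ### Positivity of the norm -/

theorem interior_cell_nonempty {lam : ℤ} (hlam : lam ≠ 0) : (interior (cell lam)).Nonempty := by
  have hsurj : Function.Surjective (cellMap lam) :=
    (LinearMap.injective_iff_surjective (f := (cellMap lam : ℂ →ₗ[ℝ] ℂ))).1
      (cellMap_injective hlam)
  refine ⟨cellMap lam ⟨1 / 2, 1 / 2⟩, mem_interior_iff_mem_nhds.2 ?_⟩
  rw [cell_eq_image]
  refine ((cellMap lam).isOpenMap hsurj).image_mem_nhds (Filter.inter_mem ?_ ?_)
  · exact continuous_re.continuousAt (Ico_mem_nhds (by norm_num) (by norm_num))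
  · exact continuous_im.continuousAt (Ico_mem_nhds (by norm_num) (by norm_num))

theorem normSqCell_nonneg (lam : ℤ) (f : ℂ → ℂ) : 0 ≤ normSqCell lam f :=
  integral_nonneg fun _ => by positivity

theorem eqOn_interior_of_normSqCell_eq_zero {lam : ℤ} {f : ℂ → ℂ}
    (hf : Continuous f) (h : normSqCell lam f = 0) : Set.EqOn f 0 (interior (cell lam)) := by
  have hi : IntegrableOn (fun z => ‖f z‖ ^ 2) (cell lam) := integrableOn_cell lam (hf.norm.pow 2)
  rw [normSqCell, setIntegral_eq_zero_iff_of_nonneg_ae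
    (Filter.Eventually.of_forall fun _ => by positivity) hi] at h
  refine Measure.eqOn_open_of_ae_eq (μ := volume) ?_ isOpen_interior hf.continuousOn
    continuousOn_const
  refine (ae_restrict_of_ae_restrict_of_subset interior_subset h).mono fun z hz => ?_
  simpa using hz

theorem normSqCell_zeroMode_pos {lam : ℤ} (hlam : lam ≠ 0) (k : ℂ) {C₀ : ℂ} (hC₀ : C₀ ≠ 0) :
    0 < normSqCell lam (fun z => C₀ * zeroMode lam k z) := by
  refine (normSqCell_nonneg _ _).lt_of_ne fun h => ?_
  have h0 := eqOn_interior_of_normSqCell_eq_zero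
    (contDiff_const.mul (contDiff_zeroMode lam k)).continuous h.symm
  obtain ⟨p, hp⟩ := interior_cell_nonempty hlam
  have hev : holPart lam k =ᶠ[nhds (conj p)] 0 := by
    have : conj ⁻¹' (interior (cell lam)) ∈ nhds (conj p) :=
      continuous_conj.continuousAt.preimage_mem_nhds
        (by rw [conj_conj]; exact isOpen_interior.mem_nhds hp)
    filter_upwards [this] with w hw
    have h1 := h0 hw
    simpa [hC₀, zeroMode_eq, zeroGauge] using h1
  -- The identity theorem spreads the vanishing from the open set to the whole plane, contradicting
  -- a nonzero theta value.
  have hall := (differentiable_holPart lam k).differentiableOn.analyticOnNhd isOpen_univ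
    |>.eqOn_zero_of_preconnected_of_eventuallyEq_zero isPreconnected_univ (Set.mem_univ _) hev
  obtain ⟨x, hx⟩ := exists_thetaChar_om_ne_zero (1 / 2) (1 / 2)
  have hl : (-4 * Real.pi * lam * I : ℂ) ≠ 0 := by simp [hlam, Real.pi_ne_zero]
  have h2 := hall (Set.mem_univ ((x + zk lam k) * (-4 * Real.pi * lam * I)))
  simp only [holPart, fk, mul_div_cancel_right₀ _ hl, add_sub_cancel_right, Pi.zero_apply,
    mul_eq_zero, exp_ne_zero, false_or, or_false] at h2
  exact hx h2

/-! ### Landau levels -/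

theorem memL2B_of_continuous {lam : ℤ} {f : ℂ → ℂ} (hf : Continuous f)
    (h : ∀ m n, magTranslation lam m n f = f) : MemL2B lam f := by
  refine ⟨fun K hK => ?_, fun m n => Filter.EventuallyEq.of_eq (h m n)⟩
  obtain ⟨C, hC⟩ := hK.exists_bound_of_continuousOn hf.continuousOn
  have : IsFiniteMeasure (volume.restrict K) := ⟨by simpa using hK.measure_lt_top⟩
  exact MemLp.of_bound hf.aestronglyMeasurable C
    ((ae_restrict_iff' hK.measurableSet).2 (Filter.Eventually.of_forall hC))

theorem magTranslation_const_mul (lam m n : ℤ) (c : ℂ) (f : ℂ → ℂ) :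
    magTranslation lam m n (fun z => c * f z) = fun z => c * magTranslation lam m n f z := by
  funext z
  simp only [magTranslation_apply]
  ring

/-- The Bloch functions of all Landau levels, obtained from the zero mode by raising. -/
def landauMode (lam : ℤ) (k C₀ : ℂ) : ℕ → ℂ → ℂ
  | 0 => fun z => C₀ * zeroMode lam k z
  | n + 1 => fun z =>
      (Real.sqrt (2 * fieldB lam * ((n : ℝ) + 1)) : ℂ)⁻¹ * aStarOp lam k (landauMode lam k C₀ n) z

theorem sqrt_level_ne_zero {lam : ℤ} (hlam : lam ≠ 0) (n : ℕ) :
    (Real.sqrt (2 * fieldB lam * ((n : ℝ) + 1)) : ℂ) ≠ 0 := by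
  have := fieldB_pos hlam
  exact ofReal_ne_zero.2 (Real.sqrt_ne_zero'.2 (by positivity))

theorem contDiff_landauMode (lam : ℤ) (k C₀ : ℂ) (n : ℕ) :
    ContDiff ℝ ∞ (landauMode lam k C₀ n) := by
  induction n with
  | zero => exact contDiff_const.mul (contDiff_zeroMode lam k)
  | succ n ih => exact contDiff_const.mul (contDiff_aStarOp ih lam k)

theorem differentiable_landauMode (lam : ℤ) (k C₀ : ℂ) (n : ℕ) :
    Differentiable ℝ (landauMode lam k C₀ n) :=
  (contDiff_landauMode lam k C₀ n).differentiable (by simp)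

theorem magTranslation_landauMode {lam : ℤ} (hlam : lam ≠ 0) (k C₀ : ℂ) (n : ℕ) (p q : ℤ) :
    magTranslation lam p q (landauMode lam k C₀ n) = landauMode lam k C₀ n := by
  induction n with
  | zero => simp only [landauMode, magTranslation_const_mul, magTranslation_zeroMode hlam]
  | succ n ih =>
    simp only [landauMode]
    rw [magTranslation_const_mul, ← aStarOp_magTranslation (differentiable_landauMode lam k C₀ n),
      ih]

theorem aStarOp_landauMode {lam : ℤ} (hlam : lam ≠ 0) (k C₀ : ℂ) (n : ℕ) (z : ℂ) :
    aStarOp lam k (landauMode lam k C₀ n) z =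
      (Real.sqrt (2 * fieldB lam * ((n : ℝ) + 1)) : ℂ) * landauMode lam k C₀ (n + 1) z := by
  rw [landauMode, mul_inv_cancel_left₀ (sqrt_level_ne_zero hlam n)]

theorem aOp_landauMode_zero (lam : ℤ) (k C₀ z : ℂ) : aOp lam k (landauMode lam k C₀ 0) z = 0 := by
  simp only [landauMode]
  rw [aOp_const_mul ((contDiff_zeroMode lam k).differentiable (by simp)), aOp_zeroMode, mul_zero]

theorem aOp_landauMode_succ {lam : ℤ} (hlam : lam ≠ 0) (k C₀ : ℂ) (n : ℕ) (z : ℂ) :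
    aOp lam k (landauMode lam k C₀ (n + 1)) z =
      (Real.sqrt (2 * fieldB lam * ((n : ℝ) + 1)) : ℂ) * landauMode lam k C₀ n z := by
  have hB := fieldB_pos hlam
  have hsq (n : ℕ) : (Real.sqrt (2 * fieldB lam * ((n : ℝ) + 1)) : ℂ) *
      (Real.sqrt (2 * fieldB lam * ((n : ℝ) + 1)) : ℂ) = 2 * fieldB lam * (n + 1) := by
    rw [← ofReal_mul, Real.mul_self_sqrt (by positivity)]
    push_cast; rfl
  have hu := contDiff_landauMode lam k C₀ n
  -- The number operator acts on level `n` by `2Bn`, by recursion on `n`; the commutator raises this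
  -- to `2B(n + 1)`.
  have key : aStarOp lam k (aOp lam k (landauMode lam k C₀ n)) z =
      2 * fieldB lam * n * landauMode lam k C₀ n z := by
    cases n with
    | zero =>
      rw [funext (aOp_landauMode_zero lam k C₀)]
      simp [aStarOp, Dzbar]
    | succ n =>
      rw [funext fun z => aOp_landauMode_succ hlam k C₀ n z,
        aStarOp_const_mul (differentiable_landauMode lam k C₀ n), aStarOp_landauMode hlam,
        ← mul_assoc, hsq]
      push_cast; rfl
  rw [landauMode, aOp_const_mul ((contDiff_aStarOp hu lam k).differentiable (by simp)),
    aOp_aStarOp hu, key, inv_mul_eq_iff_eq_mul₀ (sqrt_level_ne_zero hlam n), ← mul_assoc, hsq]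
  ring

theorem ofReal_normSqCell (lam : ℤ) (f : ℂ → ℂ) :
    (normSqCell lam f : ℂ) = ∫ z in cell lam, conj (f z) * f z := by
  rw [normSqCell, ← integral_complex_ofReal]
  congr 1 with z
  rw [mul_comm, mul_conj, normSq_eq_norm_sq]

/-- With `c = √(2B(n + 1))`, adjointness gives `c‖ψ_{n+1}‖² = ⟨a^*ψ_n, ψ_{n+1}⟩ = ⟨ψ_n, aψ_{n+1}⟩ =
c‖ψ_n‖²`. -/
theorem normSqCell_landauMode {lam : ℤ} (hlam : lam ≠ 0) (k C₀ : ℂ) (n : ℕ) :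
    normSqCell lam (landauMode lam k C₀ n) = normSqCell lam (landauMode lam k C₀ 0) := by
  induction n with
  | zero => rfl
  | succ n ih =>
    rw [← ih, ← ofReal_inj, ofReal_normSqCell, ofReal_normSqCell]
    have h := setIntegral_cell_conj_aStarOp_mul hlam k (contDiff_landauMode lam k C₀ n)
      (contDiff_landauMode lam k C₀ (n + 1)) (magTranslation_landauMode hlam k C₀ n)
      (magTranslation_landauMode hlam k C₀ (n + 1))
    simp only [aStarOp_landauMode hlam, aOp_landauMode_succ hlam, map_mul, conj_ofReal] at h
    have h0 := sqrt_level_ne_zero hlam n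
    generalize (Real.sqrt (2 * fieldB lam * ((n : ℝ) + 1)) : ℂ) = c at h h0
    simp only [mul_assoc, mul_left_comm _ c, integral_const_mul] at h
    exact mul_left_cancel₀ h0 h

/-! ### Eigenfunctions of the Dirac operator -/

theorem Cprime_zero : Cprime 0 = 1 := if_pos rfl

theorem Cprime_sq {n : ℤ} (hn : n ≠ 0) : Cprime n ^ 2 = 1 / 2 := by
  rw [Cprime, if_neg hn, div_pow, Real.sq_sqrt (by norm_num), one_pow]

theorem Cprime_ne_zero (n : ℤ) : Cprime n ≠ 0 := by
  unfold Cprime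
  split_ifs <;> positivity

theorem contDiff_spinorMode (lam : ℤ) (k C₀ : ℂ) (n : ℤ) :
    ContDiff ℝ ∞ (spinorMode (landauMode lam k C₀) n) := by
  rw [contDiff_pi]
  intro i
  fin_cases i
  · exact contDiff_const.mul (contDiff_const.mul (contDiff_landauMode lam k C₀ _))
  · exact contDiff_const.mul (contDiff_landauMode lam k C₀ _)

theorem magTranslation_spinorMode {lam : ℤ} (hlam : lam ≠ 0) (k C₀ : ℂ) (n p q : ℤ) (i : Fin 2) :
    magTranslation lam p q (fun z => spinorMode (landauMode lam k C₀) n z i) =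
      fun z => spinorMode (landauMode lam k C₀) n z i := by
  fin_cases i <;>
    simp [spinorMode, magTranslation_const_mul, magTranslation_landauMode hlam]

theorem diracExpr_spinorMode {lam : ℤ} (hlam : lam ≠ 0) (k C₀ : ℂ) (n : ℤ) (z : ℂ) (i : Fin 2) :
    diracExpr lam k (spinorMode (landauMode lam k C₀) n) z i =
      (landauLevel lam n : ℂ) * spinorMode (landauMode lam k C₀) n z i := by
  have hd := differentiable_landauMode lam k C₀
  have h0 : diracExpr lam k (spinorMode (landauMode lam k C₀) n) z 0 =
      (Cprime n : ℂ) * aOp lam k (landauMode lam k C₀ n.natAbs) z := by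
    simp only [diracExpr, spinorMode, Matrix.cons_val_zero, Matrix.cons_val_one]
    rw [aOp_const_mul (hd _)]
  have h1 : diracExpr lam k (spinorMode (landauMode lam k C₀) n) z 1 =
      (Cprime n : ℂ) * ((n.sign : ℂ) * aStarOp lam k (landauMode lam k C₀ (n.natAbs - 1)) z) := by
    simp only [diracExpr, spinorMode, Matrix.cons_val_zero, Matrix.cons_val_one]
    rw [aStarOp_const_mul ((hd _).const_mul _), aStarOp_const_mul (hd _)]
  -- At `n = 0` the truncated index `n.natAbs - 1` is `0`, but the factor `sgn 0 = 0` removes that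
  -- entry.
  rcases eq_or_ne n 0 with rfl | hn
  · fin_cases i
    · simpa [landauLevel, aOp_landauMode_zero] using h0
    · simpa [landauLevel] using h1
  · obtain ⟨j, hj⟩ := Nat.exists_eq_succ_of_ne_zero (Int.natAbs_ne_zero.2 hn)
    have hs : (n.sign : ℂ) * (n.sign : ℂ) = 1 := by
      have : n.sign * n.sign = 1 := by
        rcases Int.lt_or_gt_of_ne hn with h | h
        · rw [Int.sign_eq_neg_one_of_neg h]; rfl
        · rw [Int.sign_eq_one_of_pos h]; rfl
      exact_mod_cast this
    have hl : (landauLevel lam n : ℂ) =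
        (n.sign : ℂ) * (Real.sqrt (2 * fieldB lam * ((j : ℝ) + 1)) : ℂ) := by
      have habs : |(n : ℝ)| = (j : ℝ) + 1 := by
        rw [← Int.cast_abs, Int.abs_eq_natAbs, hj]; push_cast; rfl
      rw [landauLevel, habs, mul_right_comm 2]
      push_cast; rfl
    rw [hj, Nat.succ_eq_add_one] at h0 h1
    rw [aOp_landauMode_succ hlam] at h0
    rw [Nat.add_sub_cancel, aStarOp_landauMode hlam] at h1
    fin_cases i
    · refine h0.trans ?_
      simp only [spinorMode, hj, hl, Nat.succ_eq_add_one, Nat.add_sub_cancel]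
      simp only [Fin.zero_eta, Matrix.cons_val_zero]
      linear_combination (-(Cprime n : ℂ) * Real.sqrt (2 * fieldB lam * ((j : ℝ) + 1)) *
        landauMode lam k C₀ j z) * hs
    · refine h1.trans ?_
      simp only [spinorMode, hj, hl, Nat.succ_eq_add_one]
      simp only [Fin.mk_one, Matrix.cons_val_one, Matrix.cons_val_fin_one]
      ring

theorem diracGraph_spinorMode {lam : ℤ} (hlam : lam ≠ 0) (k C₀ : ℂ) (n : ℤ) :
    DiracGraph lam k (spinorMode (landauMode lam k C₀) n)
      (fun z i => (landauLevel lam n : ℂ) * spinorMode (landauMode lam k C₀) n z i) := by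
  have hc := contDiff_spinorMode lam k C₀ n
  have hc' (i : Fin 2) := (contDiff_pi.1 hc i).continuous
  refine ⟨fun i => memL2B_of_continuous (hc' i) fun p q =>
    magTranslation_spinorMode hlam k C₀ n p q i, fun i => memL2B_of_continuous
    (continuous_const.mul (hc' i)) fun p q => ?_, fun Φ hΦ hs => ?_⟩
  · rw [magTranslation_const_mul, magTranslation_spinorMode hlam]
  · rw [integral_conj_diracExpr hΦ hs hc]
    simp only [diracExpr_spinorMode hlam]

theorem not_ae_spinorMode_eq_zero {lam : ℤ} (hlam : lam ≠ 0) (k : ℂ) {C₀ : ℂ} (hC₀ : C₀ ≠ 0)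
    (n : ℤ) : ¬ ∀ᵐ z ∂(volume : Measure ℂ), spinorMode (landauMode lam k C₀) n z = 0 := by
  intro h
  have hpos : 0 < normSqCell lam (landauMode lam k C₀ n.natAbs) := by
    rw [normSqCell_landauMode hlam]
    exact normSqCell_zeroMode_pos hlam k hC₀
  refine hpos.ne' (integral_eq_zero_of_ae ((ae_restrict_of_ae h).mono fun z hz => ?_))
  -- The second entry is used because it is nontrivial for every `n`, whereas the first vanishes at
  -- `n = 0`.
  have h1 := congrFun hz 1
  have h2 := (mul_eq_zero.1 h1).resolve_left (ofReal_ne_zero.2 (Cprime_ne_zero n))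
  simp [h2]

theorem spinorNormSqCell_spinorMode {lam : ℤ} (hlam : lam ≠ 0) (k C₀ : ℂ) (n : ℤ) :
    spinorNormSqCell lam (spinorMode (landauMode lam k C₀) n) =
      normSqCell lam (landauMode lam k C₀ 0) := by
  rcases eq_or_ne n 0 with rfl | hn
  · simp [spinorNormSqCell, spinorMode, normSqCell, Cprime_zero]
  · have hs : ‖(n.sign : ℂ)‖ ^ 2 = 1 := by
      rcases Int.lt_or_gt_of_ne hn with h | h
      · rw [Int.sign_eq_neg_one_of_neg h]; simp
      · rw [Int.sign_eq_one_of_pos h]; simp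
    have hC : ‖(Cprime n : ℂ)‖ ^ 2 = 1 / 2 := by
      rw [norm_real, Real.norm_eq_abs, sq_abs, Cprime_sq hn]
    have hi (m : ℕ) : IntegrableOn (fun z => 1 / 2 * ‖landauMode lam k C₀ m z‖ ^ 2) (cell lam) :=
      integrableOn_cell lam
        (continuous_const.mul ((contDiff_landauMode lam k C₀ m).continuous.norm.pow 2))
    have hN := normSqCell_landauMode hlam k C₀
    simp only [normSqCell] at hN
    simp only [spinorNormSqCell, spinorMode, Matrix.cons_val_zero, Matrix.cons_val_one,
      Matrix.cons_val_fin_one, norm_mul, mul_pow, hs, hC, one_mul]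
    rw [integral_add (hi _) (hi _), integral_const_mul, integral_const_mul, hN, hN n.natAbs,
      normSqCell]
    ring

end MagneticTorus

end

theorem mainTheorem9 (lam : ℤ) (hlam : lam ≠ 0) (k : ℂ) (C₀ : ℂ) (hC₀ : C₀ ≠ 0) :
    ∃ ψ : ℕ → ℂ → ℂ,
      (∀ n, ContDiff ℝ ∞ (ψ n) ∧ MagneticTorus.MemL2B lam (ψ n)) ∧
      (∀ z, ψ 0 z = C₀ * MagneticTorus.zeroMode lam k z) ∧
      (∀ z, MagneticTorus.aOp lam k (ψ 0) z = 0) ∧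
      (∀ n z, MagneticTorus.aOp lam k (ψ (n + 1)) z =
        (Real.sqrt (2 * MagneticTorus.fieldB lam * ((n : ℝ) + 1)) : ℂ) * ψ n z) ∧
      (∀ n z, MagneticTorus.aStarOp lam k (ψ n) z =
        (Real.sqrt (2 * MagneticTorus.fieldB lam * ((n : ℝ) + 1)) : ℂ) * ψ (n + 1) z) ∧
      0 < MagneticTorus.normSqCell lam (ψ 0) ∧
      (∀ n, MagneticTorus.normSqCell lam (ψ n) = MagneticTorus.normSqCell lam (ψ 0)) ∧
      (∀ n : ℤ,
        MagneticTorus.IsDiracEigenfunction lam k (MagneticTorus.spinorMode ψ n)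
          (MagneticTorus.landauLevel lam n) ∧
        MagneticTorus.spinorNormSqCell lam (MagneticTorus.spinorMode ψ n) =
          MagneticTorus.normSqCell lam (ψ 0)) :=
  open MagneticTorus in
  ⟨landauMode lam k C₀,
    fun n => ⟨contDiff_landauMode lam k C₀ n,
      memL2B_of_continuous (contDiff_landauMode lam k C₀ n).continuous
        (magTranslation_landauMode hlam k C₀ n)⟩,
    fun _ => rfl,
    aOp_landauMode_zero lam k C₀,
    aOp_landauMode_succ hlam k C₀,
    aStarOp_landauMode hlam k C₀,
    normSqCell_zeroMode_pos hlam k hC₀,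
    normSqCell_landauMode hlam k C₀,
    fun n => ⟨⟨not_ae_spinorMode_eq_zero hlam k hC₀ n, diracGraph_spinorMode hlam k C₀ n⟩,
      spinorNormSqCell_spinorMode hlam k C₀ n⟩⟩
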